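/- Let $(\Omega,\Sigma,\mu)$ be a semi-finite measure space (every $B\in\Sigma$ with $\mu(B)=\infty$ contains some $A\in\Sigma$ with $0<\mu(A)<\infty$), let $O\subseteq\mathbb{C}^d$ be open and non-empty, and let $f:O\times\Omega\to\mathbb{C}$ be a function such that - for every $z\in O$ the function $F(z):=f(z,\cdot)$ is measurable, and $\sup_{z\in O}\operatorname{ess\,sup}_{t\in\Omega}|f(z,t)|<\infty$; - for every $t\in\Omega$ the function $f_t:=f(\cdot,t)$ is bounded and holomorphic on $O$. For a complex Banach space $E$ let $H^\infty(O;E)$ be the space of bounded holomorphic (i.e. complex Fréchet differentiable) functions $O\to E$ with the supremum norm, and $H^\infty(O):=H^\infty(O;\mathbb{C})$. Let $\alpha\in\mathbb{N}_0^d$, $a\in O$, and let $\varphi:H^\infty(O)\to\mathbb{C}$ be a linear functional that is bp-continuous: $\varphi(u_n)\to\varphi(u)$ whenever $u_n,u\in H^\infty(O)$, $u_n\to u$ pointwise on $O$ and $\sup_n\|u_n\|_\infty<\infty$. (Such a $\varphi$ is norm continuous; $\|\varphi\|$ denotes its norm in $H^\infty(O)'$.) Write $D^\alpha=\prod_j \partial^{\alpha_j}/\partial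 z_j^{\alpha_j}$, and $D^\alpha_z f(a,t):=D^\alpha(f_t)(a)$. Then: (a) $F\in H^\infty(O;L^\infty(\Omega))$ and $D^\alpha F(a)=D^\alpha_z f(a,\cdot)$ $\mu$-almost everywhere. (b) For each $g\in L^1(\Omega)$ the function $z\mapsto\int_\Omega f(z,t)g(t)\,\mu(dt)$ is holomorphic on $O$, and $$D^\alpha\Bigl(z\mapsto\int_\Omega f(z,t)g(t)\,\mu(dt)\Bigr)(a)=\int_\Omega D^\alpha_z f(a,t)\,g(t)\,\mu(dt),$$ where the integrands $f(z,\cdot)g$ ($z\in O$) and $D^\alpha_z f(a,\cdot)g$ are integrable. (c) The function $t\mapsto\varphi(f_t)$ is measurable and essentially bounded, with $$\operatorname*{ess\,sup}_{t\in\Omega}|\varphi(f_t)|\le\|\varphi\|\,\sup_{z\in O}\|F(z)\|_{L^\infty(\Omega)},$$ and its class in $L^\infty(\Omega)$ lies in the $\sigma(L^\infty,L^1)$-closure of $\operatorname{span}F(O)$. (d) For each $g\in L^1(\Omega)$ the function $t\mapsto\varphi(f_t)g(t)$ is integrable, the function $z\mapsto\int_\Omega f(z,t)g(t)\,\mu(dt)$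 belongs to $H^\infty(O)$, and $$\int_\Omega\varphi(f_t)\,g(t)\,\mu(dt)=\varphi\Bigl(z\mapsto\int_\Omega f(z,t)g(t)\,\mu(dt)\Bigr).$$ -/

import Mathlib

open Set Filter Topology MeasureTheory
open scoped ENNReal

namespace HolFubini

noncomputable section

/-- A measure is semi-finite if every measurable set of infinite measure contains a measurable
subset of finite, strictly positive measure. -/
def IsSemifinite {Ω : Type*} [MeasurableSpace Ω] (μ : Measure Ω) : Prop :=
  ∀ B : Set Ω, MeasurableSet B → μ B = ∞ →
    ∃ A : Set Ω, A ⊆ B ∧ MeasurableSet A ∧ 0 < μ A ∧ μ A < ∞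

section Holomorphic

variable {d : ℕ} {E : Type*} [NormedAddCommGroup E] [NormedSpace ℂ E]

/-- The `j`-th complex partial derivative `∂g/∂z_j`. -/
def partialDeriv (j : Fin d) (g : (Fin d → ℂ) → E) : (Fin d → ℂ) → E :=
  fun z => lineDeriv ℂ g z (Pi.single j 1)

/-- The mixed partial derivative `D^α g = ∂_1^{α_1} ⋯ ∂_d^{α_d} g`. Its values on an open set
depend only on the values of `g` on that set. -/
def multiDeriv (α : Fin d → ℕ) (g : (Fin d → ℂ) → E) : (Fin d → ℂ) → E :=
  (List.finRange d).foldr (fun j h => (partialDeriv j)^[α j] h) g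

/-- `g` restricted to `O` is a bounded holomorphic function on `O`. -/
def IsHInf (O : Set (Fin d → ℂ)) (g : (Fin d → ℂ) → E) : Prop :=
  DifferentiableOn ℂ g O ∧ ∃ C : ℝ, ∀ z ∈ O, ‖g z‖ ≤ C

variable (E) in
/-- The space `H^∞(O; E)` of bounded holomorphic functions `O → E`, with the supremum norm
(inherited from the bounded continuous functions on `O`). -/
def HInf (O : Set (Fin d → ℂ)) : Submodule ℂ (BoundedContinuousFunction O E) where
  carrier := {u | ∃ g : (Fin d → ℂ) → E, DifferentiableOn ℂ g O ∧ ∀ z : O, u z = g z}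
  zero_mem' := ⟨fun _ => 0, differentiableOn_const 0, fun _ => rfl⟩
  add_mem' := by
    rintro u v ⟨g, hg, hu⟩ ⟨h, hh, hv⟩
    exact ⟨g + h, hg.add hh, fun z => by simp [hu z, hv z]⟩
  smul_mem' := by
    rintro c u ⟨g, hg, hu⟩
    exact ⟨c • g, hg.const_smul c, fun z => by simp [hu z]⟩

/-- The element `g|_O` of `H^∞(O; E)`. -/
def IsHInf.toHInf {O : Set (Fin d → ℂ)} {g : (Fin d → ℂ) → E} (hg : IsHInf O g) : HInf E O :=
  ⟨BoundedContinuousFunction.ofNormedAddCommGroup (fun z : O => g z)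
      (continuousOn_iff_continuous_domRestrict.mp hg.1.continuousOn) hg.2.choose
      (fun z => hg.2.choose_spec z z.2),
    ⟨g, hg.1, fun _ => rfl⟩⟩

@[simp] theorem IsHInf.toHInf_apply {O : Set (Fin d → ℂ)} {g : (Fin d → ℂ) → E}
    (hg : IsHInf O g) (z : O) : hg.toHInf.1 z = g z := rfl

/-- A linear functional on `H^∞(O)` is bp-continuous if `φ (u n) → φ v` whenever `u n → v`
pointwise on `O` and the sequence `u` is uniformly bounded. -/
def BPContinuous {O : Set (Fin d → ℂ)} (φ : HInf ℂ O →ₗ[ℂ] ℂ) : Prop :=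
  ∀ (u : ℕ → HInf ℂ O) (v : HInf ℂ O),
    (∀ z : O, Tendsto (fun n => (u n).1 z) atTop (𝓝 (v.1 z))) →
    (∃ C : ℝ, ∀ n, ‖u n‖ ≤ C) →
    Tendsto (fun n => φ (u n)) atTop (𝓝 (φ v))

theorem BPContinuous.continuous {O : Set (Fin d → ℂ)} {φ : HInf ℂ O →ₗ[ℂ] ℂ}
    (hφ : BPContinuous φ) : Continuous φ := by
  rw [continuous_iff_seqContinuous]
  intro u v huv
  refine hφ u v (fun z => ?_) ?_
  · exact ((continuous_eval_const (F := BoundedContinuousFunction O ℂ) z).tendsto v.1).comp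
      ((continuous_subtype_val.tendsto v).comp huv)
  · obtain ⟨C, hC⟩ := (Metric.isBounded_range_of_tendsto u huv).exists_norm_le
    exact ⟨C, fun n => hC _ (mem_range_self n)⟩

/-- A bp-continuous functional as an element of the Banach space dual `H^∞(O)'`; its norm is
the operator norm `‖φ‖`. -/
def BPContinuous.toDual {O : Set (Fin d → ℂ)} {φ : HInf ℂ O →ₗ[ℂ] ℂ}
    (hφ : BPContinuous φ) : HInf ℂ O →L[ℂ] ℂ :=
  ⟨φ, hφ.continuous⟩

end Holomorphic

section Linfty

variable {Ω : Type*} [MeasurableSpace Ω]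

open Classical in
/-- The class in `L^∞(μ)` of a function `h : Ω → ℂ` (and `0` if `h` is not a.e. measurable and
essentially bounded). -/
def toLinf (μ : Measure Ω) (h : Ω → ℂ) : Lp ℂ ∞ μ :=
  if hh : MemLp h ∞ μ then hh.toLp h else 0

/-- The duality pairing `(u, g) ↦ ∫ u g dμ` between `L^∞(μ)` and `L^1(μ)`. -/
def linfPairing (μ : Measure Ω) : Lp ℂ ∞ μ →ₗ[ℂ] Lp ℂ 1 μ →ₗ[ℂ] ℂ :=
  ((ContinuousLinearMap.mul ℂ ℂ).lpPairing μ ∞ 1).toLinearMap₁₂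

theorem linfPairing_apply (μ : Measure Ω) (u : Lp ℂ ∞ μ) (g : Lp ℂ 1 μ) :
    linfPairing μ u g = ∫ t, u t * g t ∂μ :=
  (ContinuousLinearMap.mul ℂ ℂ).lpPairing_eq_integral u g

/-- The closure of a subset of `L^∞(μ)` in the weak topology `σ(L^∞, L^1)`. -/
def weakStarClosure (μ : Measure Ω) (S : Set (Lp ℂ ∞ μ)) : Set (Lp ℂ ∞ μ) :=
  closure (X := WeakBilin (linfPairing μ)) S

end Linfty

end

end HolFubini

/-!
Two independent ideas carry the proof.

*Holomorphy of `F`.* Since `O` is separable and each `f_t` is continuous, the bounds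
`‖f(z, t)‖ ≤ M` hold for all `z ∈ O` at once, off a single null set (`ae_forall_enorm_le`). On a
ball of radius `r` the Taylor remainder of a holomorphic function bounded by `M` satisfies
`‖g z - g c - g'(c)(z - c)‖ ≤ 4 M (‖z - c‖ / r)²`, by the Schwarz lemma
(`norm_sub_sub_fderiv_le`). Applied to almost every `f_t`, this bound is uniform in `t`, so it is a
bound in the norm of `L^∞`; hence `F` is differentiable, with derivative the class of the derivatives
(`IsHolFamily.exists_hasFDerivAt_toLinf`). The derivatives of the `f_t` again form a family that is
measurable in `t`, holomorphic in `z`, and locally essentially bounded, so the argument iterates to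
all `D^α`, also after composition with a continuous linear map on `L^∞`
(`IsImageOfFamily.multiDeriv`). The functional `u ↦ ∫ u g` yields differentiation under the integral.

*The functional `φ`.* It is a norm limit of finite linear combinations of point evaluations
(`BPContinuous.exists_finset_approx`). By bp-continuity and equicontinuity of bounded sets, for
each `ε` there are a finite `Z ⊆ O` and a constant `C` with
`‖φ u‖ ≤ max (ε ‖u‖) (C max_{z ∈ Z} ‖u z‖)`; by the Hahn–Banach theorem on `H^∞(O) × ℂ^Z`, `φ` is
then the sum of a functional of norm at most `ε` and a combination of evaluations at points of `Z`.
Consequently `t ↦ φ(f_t)` is a pointwise limit of combinations of the functions `f(z, ·)`, so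
measurable; its class is a norm limit in `L^∞` of elements of `span F(O)`, and so lies in the weak-*
closure; and the Fubini identity, plain for point evaluations, passes to the limit.
-/

namespace HolFubini

/-! ### Cauchy estimates and uniform limits in several complex variables -/

section CauchyEstimates

theorem mapsTo_closedBall_of_norm_le {E G : Type*} [SeminormedAddCommGroup E]
    [SeminormedAddCommGroup G] {g : E → G} {c : E} {r M : ℝ} (hr : 0 < r)
    (hM : ∀ z ∈ Metric.ball c r, ‖g z‖ ≤ M) :
    MapsTo g (Metric.ball c r) (Metric.closedBall (g c) (2 * M)) := fun z hz => by
  rw [mem_closedBall_iff_norm, two_mul]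
  exact (norm_sub_le _ _).trans (add_le_add (hM z hz) (hM c (Metric.mem_ball_self hr)))

theorem exists_step {E : Type*} [SeminormedAddCommGroup E] {r : ℝ} (hr : 0 < r) (v : E) :
    ∃ η > 0, η * ‖v‖ < r :=
  ⟨r / (‖v‖ + 1), by positivity, by
    rw [div_mul_eq_mul_div, div_lt_iff₀ (by positivity)]
    nlinarith [norm_nonneg v]⟩

variable {E G : Type*} [NormedAddCommGroup E] [NormedSpace ℂ E]
  [NormedAddCommGroup G] [NormedSpace ℂ G]

theorem norm_fderiv_le_of_norm_le {g : E → G} {c : E} {r M : ℝ} (hr : 0 < r)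
    (hd : DifferentiableOn ℂ g (Metric.ball c r)) (hM : ∀ z ∈ Metric.ball c r, ‖g z‖ ≤ M) :
    ‖fderiv ℂ g c‖ ≤ 2 * M / r :=
  Complex.norm_fderiv_le_div_of_mapsTo_ball hd (mapsTo_closedBall_of_norm_le hr hM) hr

/-- The second-order Taylor remainder of a holomorphic map bounded by `M` on a ball is controlled
by `M` and the radius alone. It is the Schwarz lemma for maps vanishing to second order. -/
theorem norm_sub_sub_fderiv_le {g : E → G} {c z : E} {r M : ℝ} (hr : 0 < r)
    (hd : DifferentiableOn ℂ g (Metric.ball c r)) (hM : ∀ z ∈ Metric.ball c r, ‖g z‖ ≤ M)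
    (hz : z ∈ Metric.ball c r) :
    ‖g z - g c - fderiv ℂ g c (z - c)‖ ≤ 4 * M * (‖z - c‖ / r) ^ 2 := by
  have hM0 : 0 ≤ M := (norm_nonneg _).trans (hM c (Metric.mem_ball_self hr))
  have hgc : HasFDerivAt g (fderiv ℂ g c) c :=
    (hd.differentiableAt (Metric.ball_mem_nhds c hr)).hasFDerivAt
  set k : E → G := fun w => g w - fderiv ℂ g c (w - c) with hk
  have hkc : k c = g c := by simp [hk]
  have hks : ∀ w, k w - k c = g w - g c - fderiv ℂ g c (w - c) := fun w => by
    rw [hkc]; simp only [hk]; abel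
  have hkd : DifferentiableOn ℂ k (Metric.ball c r) :=
    hd.sub ((fderiv ℂ g c).differentiable.comp_differentiableOn
      (differentiableOn_id.sub_const c))
  have hmaps : MapsTo k (Metric.ball c r) (Metric.closedBall (k c) (4 * M)) := fun w hw => by
    rw [mem_closedBall_iff_norm, hks]
    have h1 : ‖g w - g c‖ ≤ 2 * M :=
      mem_closedBall_iff_norm.1 (mapsTo_closedBall_of_norm_le hr hM hw)
    have h2 : ‖fderiv ℂ g c (w - c)‖ ≤ 2 * M / r * r :=
      (fderiv ℂ g c).le_of_opNorm_le_of_le (norm_fderiv_le_of_norm_le hr hd hM)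
        (mem_ball_iff_norm.1 hw).le
    rw [div_mul_cancel₀ _ hr.ne'] at h2
    linarith [norm_sub_le (g w - g c) (fderiv ℂ g c (w - c))]
  have ho : (fun w => k w - k c) =o[𝓝 c] (fun w => ‖w - c‖ ^ 1) := by
    simp only [hks, pow_one]
    exact hgc.isLittleO.norm_right
  have := Complex.dist_le_mul_div_pow_of_mapsTo_ball_of_isLittleO hkd hmaps ho hz
  rwa [dist_eq_norm, dist_eq_norm, hks] at this

/-- Weierstrass' theorem: a uniform limit of holomorphic maps is holomorphic. By the Cauchy
estimates the derivatives are uniformly Cauchy on a smaller ball. -/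
theorem differentiableAt_of_tendstoUniformlyOn_ball [CompleteSpace G] {q : ℕ → E → G} {l : E → G}
    {c : E} {r : ℝ} (hr : 0 < r) (hd : ∀ n, DifferentiableOn ℂ (q n) (Metric.ball c r))
    (hq : TendstoUniformlyOn q l atTop (Metric.ball c r)) : DifferentiableAt ℂ l c := by
  have hsub : ∀ z ∈ Metric.ball c (r / 2), Metric.ball z (r / 2) ⊆ Metric.ball c r :=
    fun z hz => Metric.ball_subset_ball' (by linarith [Metric.mem_ball.1 hz])
  have hdiff : ∀ n, ∀ z ∈ Metric.ball c (r / 2), DifferentiableAt ℂ (q n) z := fun n z hz =>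
    (hd n).differentiableAt (Metric.isOpen_ball.mem_nhds
      (Metric.ball_subset_ball (by linarith) hz))
  have hcau : UniformCauchySeqOn (fun n => fderiv ℂ (q n)) atTop (Metric.ball c (r / 2)) := by
    rw [Metric.uniformCauchySeqOn_iff]
    intro ε hε
    obtain ⟨N, hN⟩ := Metric.uniformCauchySeqOn_iff.1 hq.uniformCauchySeqOn (ε * r / 8)
      (by positivity)
    refine ⟨N, fun m hm n hn z hz => ?_⟩
    have hle := norm_fderiv_le_of_norm_le (g := q m - q n) (c := z) (r := r / 2) (M := ε * r / 8)
      (by linarith) (((hd m).sub (hd n)).mono (hsub z hz)) fun w hw => by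
        rw [Pi.sub_apply, ← dist_eq_norm]; exact (hN m hm n hn w (hsub z hz hw)).le
    rw [fderiv_sub (hdiff m z hz) (hdiff n z hz)] at hle
    rw [dist_eq_norm]
    have : 2 * (ε * r / 8) / (r / 2) = ε / 2 := by field_simp; norm_num
    linarith
  have hlim : ∀ z ∈ Metric.ball c (r / 2), ∃ L, Tendsto (fun n => fderiv ℂ (q n) z) atTop (𝓝 L) :=
    fun z hz => cauchySeq_tendsto_of_complete (hcau.cauchySeq hz)
  choose! L hL using hlim
  exact (hasFDerivAt_of_tendstoUniformlyOn Metric.isOpen_ball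
    (hcau.tendstoUniformlyOn_of_tendsto hL) (fun n z hz => (hdiff n z hz).hasFDerivAt)
    (fun z hz => hq.tendsto_at (Metric.ball_subset_ball (by linarith) hz))
    (Metric.mem_ball_self (by linarith))).differentiableAt

theorem exists_ball_norm_le {O : Set E} (hO : IsOpen O) {g : E → G} (hg : DifferentiableOn ℂ g O)
    {c : E} (hc : c ∈ O) :
    ∃ r > 0, Metric.ball c r ⊆ O ∧ ∃ M, ∀ z ∈ Metric.ball c r, ‖g z‖ ≤ M := by
  have h1 : ∀ᶠ z in 𝓝 c, ‖g z‖ < ‖g c‖ + 1 :=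
    ((hg.differentiableAt (hO.mem_nhds hc)).continuousAt.norm).eventually_lt_const (by linarith)
  obtain ⟨r, hr, h⟩ := Metric.eventually_nhds_iff_ball.1 (h1.and (hO.mem_nhds hc))
  exact ⟨r, hr, fun z hz => (h z hz).2, _, fun z hz => (h z hz).1.le⟩

/-- Step sizes `η / (n + 1)`, tending to `0`, for difference quotients. -/
noncomputable def quotientStep (η : ℝ) (n : ℕ) : ℂ := ((η / (n + 1) : ℝ) : ℂ)

theorem norm_quotientStep {η : ℝ} (hη : 0 < η) (n : ℕ) : ‖quotientStep η n‖ = η / (n + 1) := by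
  rw [quotientStep, Complex.norm_real, Real.norm_of_nonneg (by positivity)]

theorem norm_quotientStep_le {η : ℝ} (hη : 0 < η) (n : ℕ) : ‖quotientStep η n‖ ≤ η := by
  rw [norm_quotientStep hη]
  exact div_le_self hη.le (by linarith [n.cast_nonneg (α := ℝ)])

theorem quotientStep_ne_zero {η : ℝ} (hη : 0 < η) (n : ℕ) : quotientStep η n ≠ 0 := by
  rw [← norm_pos_iff, norm_quotientStep hη]; positivity

theorem tendsto_norm_quotientStep {η : ℝ} (hη : 0 < η) :
    Tendsto (fun n => ‖quotientStep η n‖) atTop (𝓝 0) := by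
  simp only [norm_quotientStep hη]
  exact tendsto_const_div_atTop_nhds_zero_nat η |>.comp (tendsto_add_atTop_nat 1) |>.congr
    fun n => by simp

/-- Difference quotients converge to the directional derivative at a rate depending only on the
radius of a ball and on a bound there. -/
theorem norm_quotient_sub_fderiv_le {g : E → G} {c v : E} {r M : ℝ} {h : ℂ} (hr : 0 < r)
    (hd : DifferentiableOn ℂ g (Metric.ball c r)) (hM : ∀ z ∈ Metric.ball c r, ‖g z‖ ≤ M)
    (h0 : h ≠ 0) (hh : ‖h‖ * ‖v‖ < r) :
    ‖h⁻¹ • (g (c + h • v) - g c) - fderiv ℂ g c v‖ ≤ 4 * M * (‖v‖ / r) ^ 2 * ‖h‖ := by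
  have hrem := norm_sub_sub_fderiv_le (z := c + h • v) hr hd hM (by
    rw [mem_ball_iff_norm, add_sub_cancel_left, norm_smul]; exact hh)
  rw [add_sub_cancel_left, map_smul, norm_smul] at hrem
  have hn : 0 < ‖h‖ := norm_pos_iff.2 h0
  have heq : h⁻¹ • (g (c + h • v) - g c) - fderiv ℂ g c v
      = h⁻¹ • (g (c + h • v) - g c - h • fderiv ℂ g c v) := by
    rw [smul_sub h⁻¹ (g (c + h • v) - g c), inv_smul_smul₀ h0]
  rw [heq, norm_smul, norm_inv, inv_mul_le_iff₀ hn]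
  calc _ ≤ _ := hrem
    _ = _ := by ring

/-- A directional derivative of a holomorphic map is holomorphic: it is a locally uniform limit of
difference quotients. -/
theorem differentiableOn_lineDeriv [CompleteSpace G] {O : Set E} (hO : IsOpen O) {g : E → G}
    (hg : DifferentiableOn ℂ g O) (v : E) :
    DifferentiableOn ℂ (fun z => lineDeriv ℂ g z v) O := by
  intro c hc
  obtain ⟨r, hr, hrO, M, hM⟩ := exists_ball_norm_le hO hg hc
  obtain ⟨η, hη, hηr⟩ := exists_step (half_pos hr) v
  have hsub : ∀ z ∈ Metric.ball c (r / 2), Metric.ball z (r / 2) ⊆ Metric.ball c r :=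
    fun z hz => Metric.ball_subset_ball' (by linarith [Metric.mem_ball.1 hz])
  have hstep : ∀ n, ‖quotientStep η n‖ * ‖v‖ < r / 2 := fun n =>
    (mul_le_mul_of_nonneg_right (norm_quotientStep_le hη n) (norm_nonneg v)).trans_lt hηr
  have hgr := hg.mono hrO
  refine (differentiableAt_of_tendstoUniformlyOn_ball (half_pos hr) (q := fun n z =>
    (quotientStep η n)⁻¹ • (g (z + quotientStep η n • v) - g z)) (fun n => ?_)
    ?_).differentiableWithinAt
  · refine ((hgr.comp (differentiableOn_id.add_const _) fun z hz => ?_).sub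
      (hgr.mono (Metric.ball_subset_ball (by linarith)))).const_smul _
    refine hsub z hz ?_
    rw [mem_ball_iff_norm, id, add_sub_cancel_left, norm_smul]
    exact hstep n
  · rw [Metric.tendstoUniformlyOn_iff]
    intro ε hε
    have hlim := (tendsto_norm_quotientStep hη).const_mul (4 * M * (‖v‖ / (r / 2)) ^ 2)
    rw [mul_zero] at hlim
    filter_upwards [hlim.eventually_lt_const hε] with n hn z hz
    have hzd : DifferentiableAt ℂ g z := hgr.differentiableAt
      (Metric.isOpen_ball.mem_nhds (Metric.ball_subset_ball (by linarith) hz))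
    rw [dist_comm, dist_eq_norm, hzd.lineDeriv_eq_fderiv]
    exact (norm_quotient_sub_fderiv_le (half_pos hr) (hgr.mono (hsub z hz))
      (fun w hw => hM w (hsub z hz hw)) (quotientStep_ne_zero hη n) (hstep n)).trans_lt hn

end CauchyEstimates

/-! ### Approximation of bp-continuous functionals by point evaluations -/

section FiniteApproximation

variable {d : ℕ} {O : Set (Fin d → ℂ)}

theorem norm_hInf_apply_le (u : HInf ℂ O) (z : O) : ‖u.1 z‖ ≤ ‖u‖ :=
  BoundedContinuousFunction.norm_coe_le_norm u.1 z

theorem IsHInf.norm_toHInf_le {g : (Fin d → ℂ) → ℂ} (hg : IsHInf O g) {M : ℝ} (hM : 0 ≤ M)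
    (h : ∀ z ∈ O, ‖g z‖ ≤ M) : ‖hg.toHInf‖ ≤ M :=
  (BoundedContinuousFunction.norm_le hM).2 fun z => h z z.2

/-- A bounded subset of `H^∞(O)` is locally equi-Lipschitz. -/
theorem norm_hInf_apply_le_add (u : HInf ℂ O) (hu : ‖u‖ ≤ 1) {z w : O} {r : ℝ} (hr : 0 < r)
    (hzr : Metric.ball (z : Fin d → ℂ) r ⊆ O) (hw : dist w z < r) :
    ‖u.1 z‖ ≤ ‖u.1 w‖ + 2 / r * dist w z := by
  obtain ⟨g, hg, hug⟩ := u.2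
  have hM : ∀ x ∈ Metric.ball (z : Fin d → ℂ) r, ‖g x‖ ≤ 1 := fun x hx => by
    rw [← hug ⟨x, hzr hx⟩]
    exact (norm_hInf_apply_le u _).trans hu
  have := Complex.dist_le_div_mul_dist_of_mapsTo_ball (hg.mono hzr)
    (mapsTo_closedBall_of_norm_le hr hM) (z := (w : Fin d → ℂ)) hw
  rw [← hug w, ← hug z, mul_one, dist_comm, dist_eq_norm] at this
  have h2 := norm_le_norm_add_norm_sub' (u.1 z) (u.1 w)
  exact h2.trans (add_le_add_right this _)

/-- On the unit ball of `H^∞(O)` a bp-continuous functional is continuous at `0` for the topology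
of pointwise convergence: otherwise functions that are ever smaller on longer initial segments of
a dense sequence, while `φ` stays away from `0`, would converge pointwise to `0` by
equicontinuity. -/
theorem BPContinuous.exists_finset_small (hO : IsOpen O) (hOne : O.Nonempty)
    {φ : HInf ℂ O →ₗ[ℂ] ℂ} (hφ : BPContinuous φ) {ε : ℝ} (hε : 0 < ε) :
    ∃ (Z : Finset O) (δ : ℝ), 0 < δ ∧
      ∀ u : HInf ℂ O, ‖u‖ ≤ 1 → (∀ z ∈ Z, ‖u.1 z‖ ≤ δ) → ‖φ u‖ ≤ ε := by
  classical
  have : Nonempty O := hOne.to_subtype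
  by_contra! hcon
  choose u hu1 hu2 hu3 using fun n : ℕ =>
    hcon ((Finset.range (n + 1)).image (TopologicalSpace.denseSeq O)) (1 / (n + 1 : ℝ))
      (by positivity)
  have hlim : Tendsto (fun n => φ (u n)) atTop (𝓝 (φ 0)) := by
    refine hφ u 0 (fun z => ?_) ⟨1, hu1⟩
    obtain ⟨r, hr, hzr⟩ := Metric.isOpen_iff.1 hO z z.2
    change Tendsto _ _ (𝓝 0)
    rw [Metric.tendsto_atTop]
    intro η hη
    obtain ⟨i, hi⟩ := (TopologicalSpace.denseRange_denseSeq O).exists_dist_lt z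
      (ε := min r (r * η / 4)) (by positivity)
    rw [dist_comm] at hi
    obtain ⟨N, hN⟩ := exists_nat_one_div_lt (half_pos hη)
    refine ⟨max i N, fun n hn => ?_⟩
    have h1 := norm_hInf_apply_le_add (u n) (hu1 n) hr hzr (hi.trans_le (min_le_left _ _))
    have h2 := hu2 n _ (Finset.mem_image_of_mem _
      (Finset.mem_range.2 (Nat.lt_succ_of_le ((le_max_left i N).trans hn))))
    have h3 : (1 : ℝ) / (n + 1) ≤ 1 / (N + 1) :=
      one_div_le_one_div_of_le (by positivity) (by
        have : (N : ℝ) ≤ n := by exact_mod_cast (le_max_right i N).trans hn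
        linarith)
    have h4 : 2 / r * dist (TopologicalSpace.denseSeq O i) z < η / 2 := by
      rw [div_mul_eq_mul_div, div_lt_iff₀ hr]
      linarith [hi.trans_le (min_le_right _ _)]
    rw [dist_zero_right]
    linarith
  rw [map_zero] at hlim
  obtain ⟨N, hN⟩ := Metric.tendsto_atTop.1 hlim ε hε
  have := hN N le_rfl
  rw [dist_zero_right] at this
  exact lt_asymm this (hu3 N)

/-- The homogeneous form of continuity at `0` on the unit ball. -/
theorem BPContinuous.exists_finset_norm_le_max (hO : IsOpen O) (hOne : O.Nonempty)
    {φ : HInf ℂ O →ₗ[ℂ] ℂ} (hφ : BPContinuous φ) {ε : ℝ} (hε : 0 < ε) :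
    ∃ (Z : Finset O) (C : ℝ), 0 ≤ C ∧
      ∀ u : HInf ℂ O, ‖φ u‖ ≤ ε * ‖u‖ ∨ ∃ z ∈ Z, ‖φ u‖ ≤ C * ‖u.1 z‖ := by
  obtain ⟨Z, δ, hδ, h⟩ := hφ.exists_finset_small hO hOne hε
  refine ⟨Z, ‖hφ.toDual‖ / δ, by positivity, fun u => ?_⟩
  by_cases hu : ∀ z ∈ Z, ‖u.1 z‖ ≤ δ * ‖u‖
  · left
    rcases eq_or_ne u 0 with rfl | hu0
    · simp
    have hn : 0 < ‖u‖ := norm_pos_iff.2 hu0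
    have hc : ‖((‖u‖⁻¹ : ℝ) : ℂ)‖ = ‖u‖⁻¹ := by
      rw [Complex.norm_real, Real.norm_of_nonneg (by positivity)]
    have := h (((‖u‖⁻¹ : ℝ) : ℂ) • u) (by rw [norm_smul, hc, inv_mul_cancel₀ hn.ne'])
      fun z hz => by
        change ‖((‖u‖⁻¹ : ℝ) : ℂ) • u.1 z‖ ≤ δ
        rw [norm_smul, hc, inv_mul_le_iff₀ hn, mul_comm]
        exact hu z hz
    rw [map_smul, norm_smul, hc, inv_mul_le_iff₀ hn] at this
    linarith
  · right
    push Not at hu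
    obtain ⟨z, hz, hlt⟩ := hu
    refine ⟨z, hz, (hφ.toDual.le_opNorm u).trans ?_⟩
    rw [div_mul_eq_mul_div, le_div_iff₀ hδ, mul_assoc]
    exact mul_le_mul_of_nonneg_left (by linarith) (norm_nonneg _)

/-- A bp-continuous functional is a norm limit of finite linear combinations of point evaluations.
The Hahn–Banach theorem on `H^∞(O) × ℂ^Z` splits a functional dominated by
`max (ε * ‖u‖) (C * max_{z ∈ Z} ‖u z‖)` into a part of norm at most `ε` and a part that depends
only on the values on `Z`. -/
theorem BPContinuous.exists_finset_approx (hO : IsOpen O) (hOne : O.Nonempty)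
    {φ : HInf ℂ O →ₗ[ℂ] ℂ} (hφ : BPContinuous φ) {ε : ℝ} (hε : 0 < ε) :
    ∃ (Z : Finset O) (c : O → ℂ),
      ∀ u : HInf ℂ O, ‖φ u - ∑ z ∈ Z, c z * u.1 z‖ ≤ ε * ‖u‖ := by
  classical
  obtain ⟨Z, C, hC, h⟩ := hφ.exists_finset_norm_le_max hO hOne hε
  have hnε : ‖(ε : ℂ)‖ = ε := by rw [Complex.norm_real, Real.norm_of_nonneg hε.le]
  have hnC : ‖(C : ℂ)‖ = C := by rw [Complex.norm_real, Real.norm_of_nonneg hC]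
  let R : HInf ℂ O →ₗ[ℂ] (Z → ℂ) :=
    { toFun := fun u z => (C : ℂ) * u.1 z
      map_add' := fun u v => by ext z; exact mul_add _ _ _
      map_smul' := fun a u => by ext z; exact mul_left_comm _ _ _ }
  let T : HInf ℂ O →ₗ[ℂ] HInf ℂ O × (Z → ℂ) := ((ε : ℂ) • LinearMap.id).prod R
  have hT : Function.Injective T := fun u v huv =>
    smul_right_injective _ (Complex.ofReal_ne_zero.2 hε.ne') (congrArg Prod.fst huv)
  have hdom : ∀ u, ‖φ u‖ ≤ ‖T u‖ := fun u => by
    rcases h u with h1 | ⟨z, hz, h1⟩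
    · refine h1.trans (le_trans (le_of_eq ?_) (norm_fst_le (T u)))
      change _ = ‖(ε : ℂ) • u‖
      rw [norm_smul, hnε]
    · refine h1.trans (le_trans (le_trans (le_of_eq ?_) (norm_le_pi_norm (R u) ⟨z, hz⟩))
        (norm_snd_le (T u)))
      change _ = ‖(C : ℂ) * u.1 z‖
      rw [norm_mul, hnC]
  obtain ⟨Ψ, hΨ, hle⟩ := Module.Dual.exists_extension_of_le_seminorm (LinearMap.range T)
    (φ ∘ₗ (LinearEquiv.ofInjective T hT).symm.toLinearMap)
    (p := normSeminorm ℂ (HInf ℂ O × (Z → ℂ))) (by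
      rintro ⟨_, u, rfl⟩
      have : (LinearEquiv.ofInjective T hT).symm ⟨T u, u, rfl⟩ = u :=
        (LinearEquiv.ofInjective T hT).symm_apply_apply u
      simpa [this] using hdom u)
  have hΨT : ∀ u, Ψ (T u) = φ u := fun u => by
    have : (LinearEquiv.ofInjective T hT).symm ⟨T u, u, rfl⟩ = u :=
      (LinearEquiv.ofInjective T hT).symm_apply_apply u
    simpa [this] using hΨ ⟨T u, u, rfl⟩
  have hpi : ∀ y : Z → ℂ, Ψ (0, y) = ∑ z : Z, y z * Ψ (0, fun w => if z = w then 1 else 0) :=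
    fun y => (Ψ ∘ₗ LinearMap.inr ℂ (HInf ℂ O) (Z → ℂ)).pi_apply_eq_sum_univ y
  refine ⟨Z, fun z => if hz : z ∈ Z then C * Ψ (0, fun w => if ⟨z, hz⟩ = w then 1 else 0) else 0,
    fun u => ?_⟩
  have hsum : ∑ z ∈ Z, (if hz : z ∈ Z then C * Ψ (0, fun w => if ⟨z, hz⟩ = w then 1 else 0)
      else 0) * u.1 z = Ψ (0, R u) := by
    rw [hpi, ← Finset.sum_coe_sort Z]
    refine Finset.sum_congr rfl fun z _ => ?_
    rw [dif_pos z.2]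
    change _ = (C : ℂ) * u.1 z * _
    ring
  have hsplit : φ u - Ψ (0, R u) = Ψ ((ε : ℂ) • u, 0) := by
    rw [← hΨT, ← map_sub]
    congr 1
    ext1
    · exact sub_zero _
    · exact sub_self _
  rw [hsum, hsplit]
  refine (hle _).trans (le_of_eq ?_)
  rw [coe_normSeminorm, Prod.norm_mk, norm_zero, max_eq_left (norm_nonneg _), norm_smul, hnε]

end FiniteApproximation

/-! ### Classes in `L^∞` and integration against integrable functions -/

section LinftyClasses

variable {Ω : Type*} [MeasurableSpace Ω] {μ : Measure Ω}

theorem toLinf_eq_toLp {h : Ω → ℂ} (hh : MemLp h ∞ μ) : toLinf μ h = hh.toLp h := dif_pos hh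

theorem coeFn_toLinf {h : Ω → ℂ} (hh : MemLp h ∞ μ) : toLinf μ h =ᵐ[μ] h := by
  rw [toLinf_eq_toLp hh]
  exact hh.coeFn_toLp

theorem enorm_toLinf {h : Ω → ℂ} (hh : MemLp h ∞ μ) :
    ‖toLinf μ h‖ₑ = essSup (fun t => ‖h t‖ₑ) μ := by
  rw [toLinf_eq_toLp hh, Lp.enorm_toLp, eLpNorm_exponent_top, eLpNormEssSup_eq_essSup_enorm]

theorem toLinf_add {h k : Ω → ℂ} (hh : MemLp h ∞ μ) (hk : MemLp k ∞ μ) :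
    toLinf μ (fun t => h t + k t) = toLinf μ h + toLinf μ k := by
  rw [toLinf_eq_toLp hh, toLinf_eq_toLp hk, ← MemLp.toLp_add hh hk]
  exact toLinf_eq_toLp (hh.add hk)

theorem toLinf_sub {h k : Ω → ℂ} (hh : MemLp h ∞ μ) (hk : MemLp k ∞ μ) :
    toLinf μ (fun t => h t - k t) = toLinf μ h - toLinf μ k := by
  rw [toLinf_eq_toLp hh, toLinf_eq_toLp hk, ← MemLp.toLp_sub hh hk]
  exact toLinf_eq_toLp (hh.sub hk)

theorem toLinf_const_mul (c : ℂ) {h : Ω → ℂ} (hh : MemLp h ∞ μ) :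
    toLinf μ (fun t => c * h t) = c • toLinf μ h := by
  rw [toLinf_eq_toLp hh, ← MemLp.toLp_const_smul c hh]
  exact toLinf_eq_toLp (hh.const_smul c)

theorem toLinf_sum {ι : Type*} (s : Finset ι) {h : ι → Ω → ℂ} (hh : ∀ i ∈ s, MemLp (h i) ∞ μ) :
    toLinf μ (fun t => ∑ i ∈ s, h i t) = ∑ i ∈ s, toLinf μ (h i) := by
  classical
  induction s using Finset.induction_on with
  | empty =>
    have h0 : MemLp (fun _ : Ω => (0 : ℂ)) ∞ μ := MemLp.zero
    simp only [Finset.sum_empty]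
    rw [toLinf_eq_toLp h0]
    exact h0.toLp_zero
  | insert i s hi ih =>
    simp only [Finset.sum_insert hi]
    rw [toLinf_add (hh i (Finset.mem_insert_self i s))
      (memLp_finsetSum s fun j hj => hh j (Finset.mem_insert_of_mem hj)),
      ih fun j hj => hh j (Finset.mem_insert_of_mem hj)]

theorem norm_toLinf_le {h : Ω → ℂ} (hm : AEStronglyMeasurable h μ) {C : ℝ} (hC : 0 ≤ C)
    (hb : ∀ᵐ t ∂μ, ‖h t‖ ≤ C) : ‖toLinf μ h‖ ≤ C := by
  rw [toLinf_eq_toLp (memLp_top_of_bound hm C hb), Lp.norm_toLp]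
  refine ENNReal.toReal_le_of_le_ofReal hC ?_
  rw [eLpNorm_exponent_top]
  exact eLpNormEssSup_le_of_ae_bound hb

/-- Integration against an integrable `g`, as a continuous linear functional on `L^∞(μ)`. -/
noncomputable def integralFunctional {g : Ω → ℂ} (hg : Integrable g μ) : Lp ℂ ∞ μ →L[ℂ] ℂ :=
  ((ContinuousLinearMap.mul ℂ ℂ).lpPairing μ ∞ 1).flip ((memLp_one_iff_integrable.2 hg).toLp g)

theorem integralFunctional_toLinf {g : Ω → ℂ} (hg : Integrable g μ) {h : Ω → ℂ}
    (hh : MemLp h ∞ μ) : integralFunctional hg (toLinf μ h) = ∫ t, h t * g t ∂μ := by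
  refine ((ContinuousLinearMap.mul ℂ ℂ).lpPairing_eq_integral _ _).trans (integral_congr_ae ?_)
  filter_upwards [coeFn_toLinf hh, (memLp_one_iff_integrable.2 hg).coeFn_toLp] with t h1 h2
  rw [h1, h2]
  rfl

theorem integrable_mul_of_memLp_top {g : Ω → ℂ} (hg : Integrable g μ) {h : Ω → ℂ}
    (hh : MemLp h ∞ μ) : Integrable (fun t => h t * g t) μ :=
  memLp_one_iff_integrable.1 ((memLp_one_iff_integrable.2 hg).mul' hh)

/-- The norm topology of `L^∞` is finer than `σ(L^∞, L^1)`. -/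
theorem closure_subset_weakStarClosure (S : Set (Lp ℂ ∞ μ)) :
    closure S ⊆ weakStarClosure μ S := by
  let ι : Lp ℂ ∞ μ → WeakBilin (linfPairing μ) := fun u => u
  have hι : Continuous ι := WeakBilin.continuous_of_continuous_eval _ fun g =>
    (((ContinuousLinearMap.mul ℂ ℂ).lpPairing μ ∞ 1).flip g).continuous
  have := image_closure_subset_closure_image hι (s := S)
  rw [show ι '' S = S from image_id S, show ι '' closure S = closure S from image_id _] at this
  exact this

end LinftyClasses

/-! ### Families of holomorphic functions and their classes in `L^∞` -/

section HolomorphicFamilies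

variable {d : ℕ} {Ω : Type*} [MeasurableSpace Ω] {μ : Measure Ω} {O : Set (Fin d → ℂ)}
  {f : (Fin d → ℂ) → Ω → ℂ}

/-- A family `f z t`, measurable in `t`, holomorphic in `z ∈ O`, and locally in `z` bounded for
almost every `t`, with one null set and one bound for all `z` in a small ball. Unlike global
boundedness, this is inherited by the derivatives in `z`. -/
structure IsHolFamily (μ : Measure Ω) (O : Set (Fin d → ℂ)) (f : (Fin d → ℂ) → Ω → ℂ) : Prop where
  measurable : ∀ z ∈ O, Measurable (f z)
  differentiableOn : ∀ t, DifferentiableOn ℂ (fun z => f z t) O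
  bound : ∀ c ∈ O, ∃ r > 0, Metric.ball c r ⊆ O ∧
    ∃ M, 0 ≤ M ∧ ∀ᵐ t ∂μ, ∀ z ∈ Metric.ball c r, ‖f z t‖ ≤ M

theorem IsHolFamily.memLp (hf : IsHolFamily μ O f) {z : Fin d → ℂ} (hz : z ∈ O) :
    MemLp (f z) ∞ μ := by
  obtain ⟨r, hr, -, M, -, hM⟩ := hf.bound z hz
  exact memLp_top_of_bound (hf.measurable z hz).aestronglyMeasurable M
    (hM.mono fun t ht => ht z (Metric.mem_ball_self hr))

theorem IsHolFamily.lineDeriv (hO : IsOpen O) (hf : IsHolFamily μ O f) (v : Fin d → ℂ) :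
    IsHolFamily μ O (fun z t => lineDeriv ℂ (fun w => f w t) z v) where
  measurable z hz := by
    obtain ⟨r, hr, hzr⟩ := Metric.isOpen_iff.1 hO z hz
    obtain ⟨η, hη, hηr⟩ := exists_step hr v
    refine measurable_of_tendsto_metrizable (f := fun n t =>
      (quotientStep η n)⁻¹ * (f (z + quotientStep η n • v) t - f z t)) (fun n => ?_) ?_
    · refine ((hf.measurable _ (hzr ?_)).sub (hf.measurable z hz)).const_mul _
      rw [mem_ball_iff_norm, add_sub_cancel_left, norm_smul]
      exact (mul_le_mul_of_nonneg_right (norm_quotientStep_le hη n) (norm_nonneg v)).trans_lt hηr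
    · refine tendsto_pi_nhds.2 fun t => ?_
      have hd := ((hf.differentiableOn t).differentiableAt
        (hO.mem_nhds hz)).lineDifferentiableAt (v := v)
      exact hd.hasLineDerivAt.tendsto_slope_zero.comp (tendsto_nhdsWithin_iff.2
        ⟨tendsto_zero_iff_norm_tendsto_zero.2 (tendsto_norm_quotientStep hη),
          Eventually.of_forall (quotientStep_ne_zero hη)⟩)
  differentiableOn t := differentiableOn_lineDeriv hO (hf.differentiableOn t) v
  bound c hc := by
    obtain ⟨r, hr, hrO, M, hM0, hM⟩ := hf.bound c hc
    have hsub : ∀ z ∈ Metric.ball c (r / 2), Metric.ball z (r / 2) ⊆ Metric.ball c r :=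
      fun z hz => Metric.ball_subset_ball' (by linarith [Metric.mem_ball.1 hz])
    have hrO' := (Metric.ball_subset_ball (x := c) (by linarith : r / 2 ≤ r)).trans hrO
    refine ⟨r / 2, half_pos hr, hrO', 2 * M / (r / 2) * ‖v‖, by positivity, ?_⟩
    filter_upwards [hM] with t ht z hz
    rw [((hf.differentiableOn t).differentiableAt (hO.mem_nhds (hrO' hz))).lineDeriv_eq_fderiv]
    exact ContinuousLinearMap.le_of_opNorm_le _ (norm_fderiv_le_of_norm_le (half_pos hr)
      ((hf.differentiableOn t).mono ((hsub z hz).trans hrO)) fun w hw => ht w (hsub z hz hw)) v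

/-- The class of `f z ·` in `L^∞` depends holomorphically on `z`, because the Taylor remainders are
of second order uniformly in `t`; its derivative is the class of the derivatives. -/
theorem IsHolFamily.exists_hasFDerivAt_toLinf (hO : IsOpen O) (hf : IsHolFamily μ O f)
    {c : Fin d → ℂ} (hc : c ∈ O) :
    ∃ L : (Fin d → ℂ) →L[ℂ] Lp ℂ ∞ μ,
      (∀ v, L v = toLinf μ (fun t => _root_.lineDeriv ℂ (fun w => f w t) c v)) ∧
      HasFDerivAt (fun z => toLinf μ (f z)) L c := by
  obtain ⟨r, hr, hrO, M, hM0, hM⟩ := hf.bound c hc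
  have hD : ∀ t v, _root_.lineDeriv ℂ (fun w => f w t) c v = fderiv ℂ (fun w => f w t) c v :=
    fun t v => ((hf.differentiableOn t).differentiableAt (hO.mem_nhds hc)).lineDeriv_eq_fderiv
  have hmem : ∀ v, MemLp (fun t => fderiv ℂ (fun w => f w t) c v) ∞ μ := fun v => by
    simp only [← hD]
    exact (hf.lineDeriv hO v).memLp hc
  let L₀ : (Fin d → ℂ) →ₗ[ℂ] Lp ℂ ∞ μ :=
    { toFun := fun v => toLinf μ (fun t => fderiv ℂ (fun w => f w t) c v)
      map_add' := fun v w => by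
        simp only [map_add]
        exact toLinf_add (hmem v) (hmem w)
      map_smul' := fun a v => by
        simp only [map_smul, smul_eq_mul]
        exact toLinf_const_mul a (hmem v) }
  refine ⟨L₀.toContinuousLinearMap, fun v => ?_, ?_⟩
  · simp only [hD]
    rfl
  · rw [hasFDerivAt_iff_isLittleO]
    refine Asymptotics.IsBigO.trans_isLittleO (g := fun z => ‖z - c‖ ^ 2) ?_ ?_
    · refine Asymptotics.IsBigO.of_bound (4 * M / r ^ 2) ?_
      filter_upwards [Metric.ball_mem_nhds c hr] with z hz
      have hz' := hf.memLp (hrO hz)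
      have heq : toLinf μ (f z) - toLinf μ (f c) - L₀.toContinuousLinearMap (z - c)
          = toLinf μ (fun t => f z t - f c t - fderiv ℂ (fun w => f w t) c (z - c)) := by
        rw [toLinf_sub (h := fun t => f z t - f c t) (hz'.sub (hf.memLp hc)) (hmem (z - c)),
          toLinf_sub hz' (hf.memLp hc)]
        rfl
      rw [heq]
      refine norm_toLinf_le ((hz'.sub (hf.memLp hc)).sub (hmem (z - c))).1 (by positivity) ?_
      filter_upwards [hM] with t ht
      refine (norm_sub_sub_fderiv_le hr ((hf.differentiableOn t).mono hrO) ht hz).trans_eq ?_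
      rw [norm_pow, norm_norm]
      ring
    · have : (fun z : Fin d → ℂ => ‖z - c‖ ^ 2) =o[𝓝 c] fun z => ‖z - c‖ ^ 1 :=
        (Asymptotics.isLittleO_pow_pow one_lt_two).comp_tendsto
          (tendsto_norm_sub_self c)
      exact (this.congr_right fun z => pow_one _).of_norm_right

theorem IsHolFamily.differentiableOn_toLinf (hO : IsOpen O) (hf : IsHolFamily μ O f) :
    DifferentiableOn ℂ (fun z => toLinf μ (f z)) O := fun _ hc =>
  let ⟨_, _, hL⟩ := hf.exists_hasFDerivAt_toLinf hO hc
  hL.differentiableAt.differentiableWithinAt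

variable {G : Type*} [NormedAddCommGroup G] [NormedSpace ℂ G]

/-- The function `H` is on `O` the image of the holomorphic family `f` under a continuous linear
map on `L^∞`. -/
def IsImageOfFamily (μ : Measure Ω) (O : Set (Fin d → ℂ)) (Λ : Lp ℂ ∞ μ →L[ℂ] G)
    (H : (Fin d → ℂ) → G) (f : (Fin d → ℂ) → Ω → ℂ) : Prop :=
  IsHolFamily μ O f ∧ EqOn H (fun z => Λ (toLinf μ (f z))) O

theorem IsImageOfFamily.partialDeriv (hO : IsOpen O) {Λ : Lp ℂ ∞ μ →L[ℂ] G}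
    {H : (Fin d → ℂ) → G} (h : IsImageOfFamily μ O Λ H f) (j : Fin d) :
    IsImageOfFamily μ O Λ (partialDeriv j H)
      (fun z t => partialDeriv j (fun w => f w t) z) := by
  refine ⟨h.1.lineDeriv hO _, fun c hc => ?_⟩
  obtain ⟨L, hLv, hL⟩ := h.1.exists_hasFDerivAt_toLinf hO hc
  have hH : HasFDerivAt H (Λ.comp L) c :=
    (Λ.hasFDerivAt.comp c hL).congr_of_eventuallyEq (h.2.eventuallyEq_of_mem (hO.mem_nhds hc))
  exact (hH.hasLineDerivAt _).lineDeriv.trans (congrArg Λ (hLv _))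

theorem IsImageOfFamily.multiDeriv (hO : IsOpen O) {Λ : Lp ℂ ∞ μ →L[ℂ] G}
    {H : (Fin d → ℂ) → G} (h : IsImageOfFamily μ O Λ H f) (α : Fin d → ℕ) :
    IsImageOfFamily μ O Λ (multiDeriv α H) (fun z t => multiDeriv α (fun w => f w t) z) := by
  have hiter : ∀ (j : Fin d) (n : ℕ) (H' : (Fin d → ℂ) → G) (f' : (Fin d → ℂ) → Ω → ℂ),
      IsImageOfFamily μ O Λ H' f' → IsImageOfFamily μ O Λ ((HolFubini.partialDeriv j)^[n] H')
        (fun z t => (HolFubini.partialDeriv j)^[n] (fun w => f' w t) z) := by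
    intro j n
    induction n with
    | zero => exact fun _ _ h' => h'
    | succ n ih =>
      intro H' f' h'
      simp only [Function.iterate_succ_apply']
      exact (ih H' f' h').partialDeriv hO j
  unfold HolFubini.multiDeriv
  induction List.finRange d with
  | nil => exact h
  | cons j l ih => exact hiter j (α j) _ _ ih

end HolomorphicFamilies

/-! ### Bounded holomorphic functions depending on a parameter -/

section BoundedFamilies

variable {d : ℕ} {Ω : Type*} [MeasurableSpace Ω] {μ : Measure Ω} {O : Set (Fin d → ℂ)}
  {f : (Fin d → ℂ) → Ω → ℂ}

/-- Bounds valid almost everywhere for each `z` hold simultaneously in `z` off one null set, by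
continuity in `z` and separability of `O`. -/
theorem ae_forall_enorm_le (hOne : O.Nonempty)
    (hcont : ∀ t, ContinuousOn (fun z => f z t) O) {S : ℝ≥0∞}
    (h : ∀ z ∈ O, ∀ᵐ t ∂μ, ‖f z t‖ₑ ≤ S) : ∀ᵐ t ∂μ, ∀ z ∈ O, ‖f z t‖ₑ ≤ S := by
  have : Nonempty O := hOne.to_subtype
  filter_upwards [ae_all_iff.2 fun n => h _ (TopologicalSpace.denseSeq O n).2] with t ht z hz
  exact (TopologicalSpace.denseRange_denseSeq O).induction_on
    (p := fun w : O => ‖f w t‖ₑ ≤ S) ⟨z, hz⟩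
    (isClosed_le (continuousOn_iff_continuous_domRestrict.1 (hcont t)).enorm continuous_const) ht

theorem isHolFamily_of_bound (hO : IsOpen O) (hmeas : ∀ z ∈ O, Measurable (f z))
    (hhol : ∀ t : Ω, IsHInf O (fun z => f z t)) {M : ℝ} (hM0 : 0 ≤ M)
    (hM : ∀ᵐ t ∂μ, ∀ z ∈ O, ‖f z t‖ ≤ M) : IsHolFamily μ O f where
  measurable := hmeas
  differentiableOn t := (hhol t).1
  bound c hc := by
    obtain ⟨r, hr, hrO⟩ := Metric.isOpen_iff.1 hO c hc
    exact ⟨r, hr, hrO, M, hM0, hM.mono fun t ht z hz => ht z (hrO hz)⟩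

/-- The function `t ↦ φ(f_t)` is a pointwise limit of linear combinations of the `f z`. -/
theorem BPContinuous.measurable_apply (hO : IsOpen O) (hOne : O.Nonempty)
    {φ : HInf ℂ O →ₗ[ℂ] ℂ} (hφ : BPContinuous φ) (hmeas : ∀ z ∈ O, Measurable (f z))
    (hhol : ∀ t : Ω, IsHInf O (fun z => f z t)) :
    Measurable (fun t => φ (hhol t).toHInf) := by
  choose Z c h using fun n : ℕ => hφ.exists_finset_approx hO hOne
    (Nat.one_div_pos_of_nat (α := ℝ) (n := n))
  refine measurable_of_tendsto_metrizable (f := fun n t => ∑ z ∈ Z n, c n z * f z t)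
    (fun n => Finset.measurable_sum _ fun z _ => (hmeas z z.2).const_mul _)
    (tendsto_pi_nhds.2 fun t => ?_)
  rw [tendsto_iff_norm_sub_tendsto_zero]
  have hlim := (tendsto_one_div_add_atTop_nhds_zero_nat (𝕜 := ℝ)).mul_const ‖(hhol t).toHInf‖
  rw [zero_mul] at hlim
  refine squeeze_zero (fun _ => norm_nonneg _) (fun n => ?_) hlim
  rw [norm_sub_rev]
  exact h n (hhol t).toHInf

theorem BPContinuous.ae_norm_apply_le {φ : HInf ℂ O →ₗ[ℂ] ℂ} (hφ : BPContinuous φ)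
    (hhol : ∀ t : Ω, IsHInf O (fun z => f z t)) {M : ℝ} (hM0 : 0 ≤ M)
    (hM : ∀ᵐ t ∂μ, ∀ z ∈ O, ‖f z t‖ ≤ M) :
    ∀ᵐ t ∂μ, ‖φ (hhol t).toHInf‖ ≤ ‖hφ.toDual‖ * M :=
  hM.mono fun t ht => hφ.toDual.le_opNorm_of_le ((hhol t).norm_toHInf_le hM0 ht)

theorem BPContinuous.memLp_apply (hO : IsOpen O) (hOne : O.Nonempty)
    {φ : HInf ℂ O →ₗ[ℂ] ℂ} (hφ : BPContinuous φ) (hmeas : ∀ z ∈ O, Measurable (f z))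
    (hhol : ∀ t : Ω, IsHInf O (fun z => f z t)) {M : ℝ} (hM0 : 0 ≤ M)
    (hM : ∀ᵐ t ∂μ, ∀ z ∈ O, ‖f z t‖ ≤ M) : MemLp (fun t => φ (hhol t).toHInf) ∞ μ :=
  memLp_top_of_bound (hφ.measurable_apply hO hOne hmeas hhol).aestronglyMeasurable _
    (hφ.ae_norm_apply_le hhol hM0 hM)

/-- An approximation of `φ` by point evaluations, uniform on bounded sets, is also an approximation
in the norm of `L^∞` of the class of `t ↦ φ(f_t)` by linear combinations of the classes of the
`f z`. -/
theorem BPContinuous.norm_toLinf_sub_sum_le (hO : IsOpen O) (hOne : O.Nonempty)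
    {φ : HInf ℂ O →ₗ[ℂ] ℂ} (hφ : BPContinuous φ) (hmeas : ∀ z ∈ O, Measurable (f z))
    (hhol : ∀ t : Ω, IsHInf O (fun z => f z t)) {M : ℝ} (hM0 : 0 ≤ M)
    (hM : ∀ᵐ t ∂μ, ∀ z ∈ O, ‖f z t‖ ≤ M) {ε : ℝ} (hε : 0 ≤ ε) {Z : Finset O} {c : O → ℂ}
    (h : ∀ u : HInf ℂ O, ‖φ u - ∑ z ∈ Z, c z * u.1 z‖ ≤ ε * ‖u‖) :
    ‖toLinf μ (fun t => φ (hhol t).toHInf) - ∑ z ∈ Z, c z • toLinf μ (f z)‖ ≤ ε * M := by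
  have hf := isHolFamily_of_bound hO hmeas hhol hM0 hM
  have hφm := hφ.memLp_apply hO hOne hmeas hhol hM0 hM
  have hterm : ∀ z ∈ Z, MemLp (fun t => c z * f z t) ∞ μ := fun z _ => (hf.memLp z.2).const_mul _
  have hsum : ∑ z ∈ Z, c z • toLinf μ (f z) = toLinf μ (fun t => ∑ z ∈ Z, c z * f z t) := by
    rw [toLinf_sum Z hterm]
    exact Finset.sum_congr rfl fun z _ => (toLinf_const_mul _ (hf.memLp z.2)).symm
  have hsm := memLp_finsetSum Z hterm
  rw [hsum, ← toLinf_sub hφm hsm]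
  refine norm_toLinf_le (hφm.sub hsm).1 (mul_nonneg hε hM0) ?_
  filter_upwards [hM] with t ht
  exact (h (hhol t).toHInf).trans
    (mul_le_mul_of_nonneg_left ((hhol t).norm_toHInf_le hM0 ht) hε)

theorem BPContinuous.toLinf_apply_mem_weakStarClosure (hO : IsOpen O) (hOne : O.Nonempty)
    {φ : HInf ℂ O →ₗ[ℂ] ℂ} (hφ : BPContinuous φ) (hmeas : ∀ z ∈ O, Measurable (f z))
    (hhol : ∀ t : Ω, IsHInf O (fun z => f z t)) {M : ℝ} (hM0 : 0 ≤ M)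
    (hM : ∀ᵐ t ∂μ, ∀ z ∈ O, ‖f z t‖ ≤ M) :
    toLinf μ (fun t => φ (hhol t).toHInf) ∈ weakStarClosure μ
      (Submodule.span ℂ ((fun z => toLinf μ (f z)) '' O) : Set (Lp ℂ ∞ μ)) := by
  refine closure_subset_weakStarClosure _ (Metric.mem_closure_iff.2 fun ε hε => ?_)
  obtain ⟨Z, c, h⟩ := hφ.exists_finset_approx hO hOne (ε := ε / (M + 1)) (by positivity)
  refine ⟨∑ z ∈ Z, c z • toLinf μ (f z), Submodule.sum_mem _ fun z _ =>
    Submodule.smul_mem _ _ (Submodule.subset_span ⟨z, z.2, rfl⟩), ?_⟩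
  rw [dist_eq_norm]
  refine (hφ.norm_toLinf_sub_sum_le hO hOne hmeas hhol hM0 hM (by positivity) h).trans_lt ?_
  rw [div_mul_eq_mul_div, div_lt_iff₀ (by positivity)]
  linarith

theorem isHInf_integral (hO : IsOpen O) (hmeas : ∀ z ∈ O, Measurable (f z))
    (hhol : ∀ t : Ω, IsHInf O (fun z => f z t)) {M : ℝ} (hM0 : 0 ≤ M)
    (hM : ∀ᵐ t ∂μ, ∀ z ∈ O, ‖f z t‖ ≤ M) {g : Ω → ℂ} (hg : Integrable g μ) :
    IsHInf O (fun z => ∫ t, f z t * g t ∂μ) := by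
  have hf := isHolFamily_of_bound hO hmeas hhol hM0 hM
  have heq : ∀ z ∈ O, ∫ t, f z t * g t ∂μ = integralFunctional hg (toLinf μ (f z)) :=
    fun z hz => (integralFunctional_toLinf hg (hf.memLp hz)).symm
  refine ⟨DifferentiableOn.congr ((integralFunctional hg).differentiable.comp_differentiableOn
    (hf.differentiableOn_toLinf hO)) heq, ‖integralFunctional hg‖ * M, fun z hz => ?_⟩
  refine (congrArg norm (heq z hz)).trans_le ?_
  exact (integralFunctional hg).le_opNorm_of_le
    (norm_toLinf_le (hmeas z hz).aestronglyMeasurable hM0 (hM.mono fun t ht => ht z hz))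

theorem BPContinuous.integral_apply_mul (hO : IsOpen O) (hOne : O.Nonempty)
    {φ : HInf ℂ O →ₗ[ℂ] ℂ} (hφ : BPContinuous φ) (hmeas : ∀ z ∈ O, Measurable (f z))
    (hhol : ∀ t : Ω, IsHInf O (fun z => f z t)) {M : ℝ} (hM0 : 0 ≤ M)
    (hM : ∀ᵐ t ∂μ, ∀ z ∈ O, ‖f z t‖ ≤ M) {g : Ω → ℂ} (hg : Integrable g μ)
    (hG : IsHInf O (fun z => ∫ t, f z t * g t ∂μ)) :
    ∫ t, φ (hhol t).toHInf * g t ∂μ = φ hG.toHInf := by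
  have hf := isHolFamily_of_bound hO hmeas hhol hM0 hM
  rw [← integralFunctional_toLinf hg (hφ.memLp_apply hO hOne hmeas hhol hM0 hM)]
  set Λ := integralFunctional hg
  set u := toLinf μ (fun t => φ (hhol t).toHInf)
  set K := ‖Λ‖ * M + ‖hG.toHInf‖
  have hK : 0 ≤ K := by positivity
  -- Both sides are within `ε * K` of the same combination of the values of the integral.
  have key : ∀ ε > 0, ‖Λ u - φ hG.toHInf‖ ≤ ε * K := fun ε hε => by
    obtain ⟨Z, c, h⟩ := hφ.exists_finset_approx hO hOne hε
    have hΛ : Λ (∑ z ∈ Z, c z • toLinf μ (f z)) = ∑ z ∈ Z, c z * hG.toHInf.1 z := by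
      rw [map_sum]
      refine Finset.sum_congr rfl fun z _ => ?_
      rw [map_smul, smul_eq_mul, integralFunctional_toLinf hg (hf.memLp z.2),
        IsHInf.toHInf_apply]
    have h1 : ‖Λ u - ∑ z ∈ Z, c z * hG.toHInf.1 z‖ ≤ ‖Λ‖ * (ε * M) := by
      rw [← hΛ, ← map_sub]
      exact Λ.le_opNorm_of_le
        (hφ.norm_toLinf_sub_sum_le hO hOne hmeas hhol hM0 hM hε.le h)
    have h2 := h hG.toHInf
    rw [norm_sub_rev] at h2
    calc _ ≤ _ := norm_sub_le_norm_sub_add_norm_sub _ (∑ z ∈ Z, c z * hG.toHInf.1 z) _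
      _ ≤ ‖Λ‖ * (ε * M) + ε * ‖hG.toHInf‖ := add_le_add h1 h2
      _ = ε * K := by ring
  refine eq_of_norm_sub_le_zero (le_of_forall_pos_le_add fun ε hε => ?_)
  rw [zero_add]
  refine (key (ε / (K + 1)) (by positivity)).trans ?_
  rw [div_mul_eq_mul_div, div_le_iff₀ (by positivity)]
  nlinarith

end BoundedFamilies

end HolFubini

/-! ### Holomorphic dependence, differentiation under the integral, and Fubini for functionals -/

open HolFubini in
theorem mainTheorem2 {d : ℕ} {Ω : Type*} [MeasurableSpace Ω] (μ : Measure Ω)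
    (hμ : IsSemifinite μ)
    (O : Set (Fin d → ℂ)) (hO : IsOpen O) (hOne : O.Nonempty)
    (f : (Fin d → ℂ) → Ω → ℂ)
    (hmeas : ∀ z ∈ O, Measurable (f z))
    (hbdd : (⨆ z ∈ O, essSup (fun t => ‖f z t‖ₑ) μ) < ∞)
    (hhol : ∀ t : Ω, IsHInf O (fun z => f z t))
    (α : Fin d → ℕ) (a : Fin d → ℂ) (ha : a ∈ O)
    (φ : HInf ℂ O →ₗ[ℂ] ℂ) (hφ : BPContinuous φ) :
    -- `F : z ↦ f(z, ·)` is a bounded holomorphic `L^∞`-valued function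
    ((∀ z ∈ O, MemLp (f z) ∞ μ) ∧
      IsHInf O (fun z => toLinf μ (f z)) ∧
      (multiDeriv α (fun z => toLinf μ (f z)) a : Lp ℂ ∞ μ)
        =ᵐ[μ] fun t => multiDeriv α (fun z => f z t) a) ∧
    -- differentiation under the integral
    (∀ g : Ω → ℂ, Integrable g μ →
      (∀ z ∈ O, Integrable (fun t => f z t * g t) μ) ∧
      DifferentiableOn ℂ (fun z => ∫ t, f z t * g t ∂μ) O ∧
      Integrable (fun t => multiDeriv α (fun z => f z t) a * g t) μ ∧
      multiDeriv α (fun z => ∫ t, f z t * g t ∂μ) a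
        = ∫ t, multiDeriv α (fun z => f z t) a * g t ∂μ) ∧
    -- the function `t ↦ φ(f_t)`
    (Measurable (fun t => φ (hhol t).toHInf) ∧
      MemLp (fun t => φ (hhol t).toHInf) ∞ μ ∧
      essSup (fun t => ‖φ (hhol t).toHInf‖ₑ) μ
        ≤ ‖hφ.toDual‖ₑ * (⨆ z ∈ O, ‖toLinf μ (f z)‖ₑ) ∧
      toLinf μ (fun t => φ (hhol t).toHInf) ∈
        weakStarClosure μ
          (Submodule.span ℂ ((fun z => toLinf μ (f z)) '' O) : Set (Lp ℂ ∞ μ))) ∧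
    -- the Fubini identity
    (∀ g : Ω → ℂ, Integrable g μ →
      Integrable (fun t => φ (hhol t).toHInf * g t) μ ∧
      ∃ hg : IsHInf O (fun z => ∫ t, f z t * g t ∂μ),
        ∫ t, φ (hhol t).toHInf * g t ∂μ = φ hg.toHInf) := by
  set S : ℝ≥0∞ := ⨆ z ∈ O, essSup (fun t => ‖f z t‖ₑ) μ with hS
  have hSM : S = ENNReal.ofReal S.toReal := (ENNReal.ofReal_toReal hbdd.ne).symm
  have hM0 : 0 ≤ S.toReal := ENNReal.toReal_nonneg
  have hMe : ∀ᵐ t ∂μ, ∀ z ∈ O, ‖f z t‖ₑ ≤ S := ae_forall_enorm_le hOne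
    (fun t => (hhol t).1.continuousOn) fun z hz =>
      (ENNReal.ae_le_essSup fun t => ‖f z t‖ₑ).mono fun t ht =>
        ht.trans (le_iSup₂ (f := fun z (_ : z ∈ O) => essSup (fun t => ‖f z t‖ₑ) μ) z hz)
  have hM : ∀ᵐ t ∂μ, ∀ z ∈ O, ‖f z t‖ ≤ S.toReal := hMe.mono fun t ht z hz => by
    rw [← toReal_enorm]
    exact ENNReal.toReal_mono hbdd.ne (ht z hz)
  have hf := isHolFamily_of_bound hO hmeas hhol hM0 hM
  refine ⟨⟨fun z hz => hf.memLp hz, ⟨hf.differentiableOn_toLinf hO, S.toReal, fun z hz =>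
      norm_toLinf_le (hmeas z hz).aestronglyMeasurable hM0 (hM.mono fun t ht => ht z hz)⟩, ?_⟩,
    fun g hg => ⟨fun z hz => integrable_mul_of_memLp_top hg (hf.memLp hz),
      (isHInf_integral hO hmeas hhol hM0 hM hg).1, ?_⟩,
    ⟨hφ.measurable_apply hO hOne hmeas hhol, hφ.memLp_apply hO hOne hmeas hhol hM0 hM, ?_,
      hφ.toLinf_apply_mem_weakStarClosure hO hOne hmeas hhol hM0 hM⟩,
    fun g hg => ⟨integrable_mul_of_memLp_top hg (hφ.memLp_apply hO hOne hmeas hhol hM0 hM),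
      isHInf_integral hO hmeas hhol hM0 hM hg,
      hφ.integral_apply_mul hO hOne hmeas hhol hM0 hM hg _⟩⟩
  · have h : IsImageOfFamily μ O (.id ℂ _) (fun z => toLinf μ (f z)) f := ⟨hf, fun _ _ => rfl⟩
    obtain ⟨hD, heq⟩ := h.multiDeriv hO α
    rw [heq ha]
    exact coeFn_toLinf (hD.memLp ha)
  · have h : IsImageOfFamily μ O (integralFunctional hg) (fun z => ∫ t, f z t * g t ∂μ) f :=
      ⟨hf, fun z hz => (integralFunctional_toLinf hg (hf.memLp hz)).symm⟩
    obtain ⟨hD, heq⟩ := h.multiDeriv hO α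
    exact ⟨integrable_mul_of_memLp_top hg (hD.memLp ha),
      (heq ha).trans (integralFunctional_toLinf hg (hD.memLp ha))⟩
  · have hsup : (⨆ z ∈ O, ‖toLinf μ (f z)‖ₑ) = S :=
      iSup_congr fun z => iSup_congr fun hz => enorm_toLinf (hf.memLp hz)
    rw [hsup]
    refine essSup_le_of_ae_le _ ?_
    filter_upwards [hφ.ae_norm_apply_le hhol hM0 hM] with t ht
    rw [hSM, ← ofReal_norm, ← ofReal_norm, ← ENNReal.ofReal_mul (norm_nonneg _)]
    exact ENNReal.ofReal_le_ofReal ht
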